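/- Let $\mathcal H_F$ be the Hilbert space of the $n$-mode quantum harmonic oscillator, with orthonormal basis of Fock states $|\mathbf k\rangle$, $\mathbf k\in\mathbb N_0^n$, and for $\mathbf z\in\mathbb C^n$ let $|\mathbf z\rangle = e^{-|\mathbf z|^2/2}\sum_{\mathbf k}(\mathbf k!)^{-1/2}\,\mathbf z^{\mathbf k}\,|\mathbf k\rangle\in\mathcal H_F$ be the normalized coherent state. Let $\iota:\mathbb R^m\to\mathbb C^n$ be a real-linear isometric embedding (for example $(\mathbf x,\mathbf y)\mapsto \mathbf x+i\mathbf y$ when $m=2n$, or the inclusion $\mathbb R^n\subset\mathbb C^n$). The Fock (coherent-state) quantum probability metric on $\mathbb R^m$ maps $x\in\mathbb R^m$ to the pure state $|\iota(x)\rangle\langle\iota(x)|$, and its dual functions are the real functions $x\mapsto\langle\iota(x)|\hat F|\iota(x)\rangle$ on $\mathbb R^m$ with $\hat F$ a bounded self-adjoint operator on $\mathcal H_F$. Then: (1) every bounded continuous function $f:\mathbb R^m\to\mathbb R$ that is band-limited (i.e. whose distributional Fourier transform has compact support) is a dual function; (2) the dual functions form a uniformly dense subset of $BUC(\mathbb R^m)$,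 the space of bounded, uniformly continuous real functions on $\mathbb R^m$: every dual function belongs to $BUC(\mathbb R^m)$, and for every $f\in BUC(\mathbb R^m)$ and every $\varepsilon>0$ there is a dual function $g$ with $|f(x)-g(x)|<\varepsilon$ for all $x\in\mathbb R^m$. -/

import Mathlib

open scoped FourierTransform SchwartzMap

noncomputable section

/-- The Hilbert space of the `n`-mode quantum harmonic oscillator, with the orthonormal Hilbert
basis of Fock states `|k⟩ = lp.single 2 k 1` indexed by the multi-indices `k : Fin n → ℕ`. -/
abbrev FockSpace (n : ℕ) : Type := lp (fun _ : Fin n → ℕ => ℂ) 2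

/-- The coefficient `⟨k|z⟩ = exp (-|z|² / 2) z ^ k / √(k!)` of the coherent state `|z⟩` with respect
to the Fock state `|k⟩`, in multi-index notation. -/
def coherentCoeff {n : ℕ} (z : EuclideanSpace ℂ (Fin n)) (k : Fin n → ℕ) : ℂ :=
  (Real.exp (-‖z‖ ^ 2 / 2) : ℂ) * ∏ i, z i ^ k i / (Real.sqrt (Nat.factorial (k i)) : ℂ)

theorem coherentCoeff_memlp {n : ℕ} (z : EuclideanSpace ℂ (Fin n)) :
    Memℓp (coherentCoeff z) 2 := by
  have key : Summable fun k : Fin n → ℕ =>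
      ∏ i, (‖z i‖ ^ 2) ^ k i / (Nat.factorial (k i) : ℝ) := by
    refine summable_of_sum_le (c := ∏ i, Real.exp (‖z i‖ ^ 2))
      (fun k => Finset.prod_nonneg fun i _ => by positivity) fun s => ?_
    have hs : s ⊆ Fintype.piFinset fun i => s.image fun k => k i := by
      intro k hk
      exact Fintype.mem_piFinset.2 fun i => Finset.mem_image_of_mem _ hk
    refine (Finset.sum_le_sum_of_subset_of_nonneg hs fun k _ _ =>
      Finset.prod_nonneg fun i _ => by positivity).trans ?_
    rw [← Finset.prod_univ_sum (fun i => s.image fun k => k i)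
      fun i j => (‖z i‖ ^ 2) ^ j / (Nat.factorial j : ℝ)]
    refine Finset.prod_le_prod (fun i _ => Finset.sum_nonneg fun j _ => by positivity)
      fun i _ => ?_
    rw [Real.exp_eq_exp_ℝ, NormedSpace.exp_eq_tsum_div]
    exact (Real.summable_pow_div_factorial _).sum_le_tsum _ fun j _ => by positivity
  refine memℓp_gen ?_
  refine (key.mul_left (Real.exp (-‖z‖ ^ 2 / 2) ^ 2)).congr fun k => ?_
  have h2 : (2 : ENNReal).toReal = ((2 : ℕ) : ℝ) := by norm_num
  rw [h2, Real.rpow_natCast, coherentCoeff, norm_mul, mul_pow, norm_prod, ← Finset.prod_pow]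
  congr 1
  · rw [Complex.norm_real, Real.norm_eq_abs, sq_abs]
  · refine Finset.prod_congr rfl fun i _ => ?_
    rw [norm_div, norm_pow, div_pow, Complex.norm_real, Real.norm_eq_abs, sq_abs,
      Real.sq_sqrt (Nat.cast_nonneg _)]
    ring

/-- The normalized coherent state
`|z⟩ = exp (-|z|² / 2) ∑ k, (k!) ^ (-1/2) z ^ k |k⟩` of the `n`-mode harmonic oscillator. -/
def coherentState {n : ℕ} (z : EuclideanSpace ℂ (Fin n)) : FockSpace n :=
  ⟨coherentCoeff z, coherentCoeff_memlp z⟩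

/-- Let `ψ x` be a unit vector representing the pure state `|x⟩⟨x|` to which a quantum probability
metric on `X` maps the point `x`. The dual functions of that metric are the real functions
`x ↦ ⟨x|A|x⟩ = tr (|x⟩⟨x| A)` for bounded self-adjoint operators `A`. -/
def IsDualFunction {X H : Type*} [NormedAddCommGroup H] [InnerProductSpace ℂ H] [CompleteSpace H]
    (ψ : X → H) (f : X → ℝ) : Prop :=
  ∃ A : H →L[ℂ] H, IsSelfAdjoint A ∧ ∀ x, (f x : ℂ) = inner ℂ (ψ x) (A (ψ x))

/-- A bounded real function on `ℝᵐ` is band-limited if the Fourier transform of the tempered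
distribution it defines has compact support, that is, vanishes outside some compact set. -/
def IsBandLimited {m : ℕ} (f : EuclideanSpace ℝ (Fin m) → ℝ) : Prop :=
  ∃ hf : MeasureTheory.MemLp (fun x => (f x : ℂ)) ⊤ MeasureTheory.volume,
    ∃ K : Set (EuclideanSpace ℝ (Fin m)), IsCompact K ∧
      Distribution.IsVanishingOn
        (𝓕 (MeasureTheory.Lp.toTemperedDistribution (hf.toLp _)) :
          𝓢'(EuclideanSpace ℝ (Fin m), ℂ)) Kᶜ

/-- Membership in `BUC(ℝᵐ)`, the bounded uniformly continuous real functions. -/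
def IsBUC {m : ℕ} (f : EuclideanSpace ℝ (Fin m) → ℝ) : Prop :=
  (∃ C : ℝ, ∀ x, |f x| ≤ C) ∧ UniformContinuous f

end

/-! The overlap of two coherent states is `exp (-‖z - w‖² / 2)` times a phase, and Gaussian wave
packets in `L²` of phase space have, once normalized, the same Gram matrix. A bounded operator
therefore carries coherent states to wave packets, and compressing multiplication by a bounded real
symbol `a` yields a self-adjoint operator whose expectations are `a` smoothed by the normalized
Gaussian `exp (-‖z‖²)`.

For a symbol `α (P z)`, with `P` the adjoint of `ι`, this smoothing restricted to `ℝᵐ` is the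
Fourier multiplier `exp (-π² ‖ξ‖²)`. It can be inverted on compact frequency sets: taking `α = f *
𝓕⁻ (χ exp (π² ‖ξ‖²))` with `χ` smooth of compact support, the kernel is Schwartz, `α` is bounded,
and the real part of `f * 𝓕⁻ χ` is a dual function. If `χ = 1` near the spectrum of `f`, this is `f`
itself; if `χ 0 = 1`, the dilates `χ (δ • ξ)` give an approximate identity on BUC.

Conversely, expectations ignore phases, and up to a phase coherent states are 1-Lipschitz in their
label, so dual functions are Lipschitz. -/

noncomputable section

open MeasureTheory
open scoped ContDiff

/-! ### Overlaps of coherent states -/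

/-- A sum over multi-indices of products factorizes. -/
theorem tsum_prod_pi {ι : Type*} [Fintype ι] {a : ι → ℕ → ℂ} {s : ι → ℂ}
    (ha : ∀ i, HasSum (a i) (s i)) (hs : Summable fun k : ι → ℕ => ∏ i, a i (k i)) :
    ∑' k : ι → ℕ, ∏ i, a i (k i) = ∏ i, s i := by
  classical
  -- Cubes are cofinal among finite sets, so the summable series can be summed along them, where the
  -- product distributes.
  have hcof : Filter.Tendsto (fun N : ℕ => Fintype.piFinset fun _ : ι => Finset.range N)
      Filter.atTop Filter.atTop := by
    refine Filter.tendsto_atTop_finset_of_monotone (fun M N h => ?_) fun k => ?_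
    · exact Fintype.piFinset_subset _ _ fun _ => Finset.range_mono h
    · refine ⟨(∑ i, k i) + 1, Fintype.mem_piFinset.2 fun i => Finset.mem_range.2 ?_⟩
      exact Nat.lt_succ_of_le (Finset.single_le_sum (fun _ _ => Nat.zero_le _) (Finset.mem_univ i))
  have h1 := hs.hasSum.comp hcof
  refine tendsto_nhds_unique h1 ?_
  have h2 : Filter.Tendsto (fun N : ℕ => ∏ i, ∑ j ∈ Finset.range N, a i j) Filter.atTop
      (nhds (∏ i, s i)) := tendsto_finsetProd _ fun i _ => (ha i).tendsto_sum_nat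
  refine h2.congr fun N => ?_
  exact Finset.prod_univ_sum (fun _ => Finset.range N) fun i j => a i j

theorem inner_coherentState {n : ℕ} (z w : EuclideanSpace ℂ (Fin n)) :
    inner ℂ (coherentState z) (coherentState w) =
      Complex.exp (-(‖z‖ : ℂ) ^ 2 / 2 - (‖w‖ : ℂ) ^ 2 / 2 + inner ℂ z w) := by
  have hterm : ∀ k : Fin n → ℕ, inner ℂ (coherentCoeff z k) (coherentCoeff w k) =
      Complex.exp (-(‖z‖ : ℂ) ^ 2 / 2 - (‖w‖ : ℂ) ^ 2 / 2) *
        ∏ i, (inner ℂ (z i) (w i)) ^ k i / (Nat.factorial (k i) : ℂ) := by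
    intro k
    simp only [coherentCoeff, RCLike.inner_apply, map_mul, map_prod, map_div₀, map_pow,
      Complex.conj_ofReal]
    rw [mul_mul_mul_comm, ← Finset.prod_mul_distrib]
    congr 1
    · rw [sub_eq_add_neg, Complex.exp_add, mul_comm]
      push_cast
      ring_nf
    · refine Finset.prod_congr rfl fun i _ => ?_
      rw [div_mul_div_comm, mul_pow, ← Complex.ofReal_mul,
        Real.mul_self_sqrt (Nat.cast_nonneg _)]
      simp
  have hs := lp.hasSum_inner (𝕜 := ℂ) (coherentState z) (coherentState w)
  have hs' : HasSum (fun k : Fin n → ℕ =>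
      Complex.exp (-(‖z‖ : ℂ) ^ 2 / 2 - (‖w‖ : ℂ) ^ 2 / 2) *
        ∏ i, (inner ℂ (z i) (w i)) ^ k i / (Nat.factorial (k i) : ℂ))
      (inner ℂ (coherentState z) (coherentState w)) := by
    refine hs.congr_fun fun k => ?_
    exact (hterm k).symm
  rw [← hs'.tsum_eq, tsum_mul_left, Complex.exp_add,
    tsum_prod_pi (a := fun i j => inner ℂ (z i) (w i) ^ j / (Nat.factorial j : ℂ))
      (s := fun i => Complex.exp (inner ℂ (z i) (w i)))]
  · rw [← Complex.exp_sum, PiLp.inner_apply]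
  · intro i
    rw [Complex.exp_eq_exp_ℂ]
    exact NormedSpace.expSeries_div_hasSum_exp _
  · exact (summable_mul_left_iff (Complex.exp_ne_zero _)).1 hs'.summable

theorem norm_coherentState {n : ℕ} (z : EuclideanSpace ℂ (Fin n)) : ‖coherentState z‖ = 1 := by
  have h := inner_self_eq_norm_sq_to_K (𝕜 := ℂ) (coherentState z)
  rw [inner_coherentState, inner_self_eq_norm_sq_to_K] at h
  have h1 : ((‖coherentState z‖ ^ 2 : ℝ) : ℂ) = 1 := by
    push_cast
    refine h.symm.trans ?_
    rw [← Complex.exp_zero]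
    congr 1
    simp only [Complex.coe_algebraMap]
    ring
  have h2 : ‖coherentState z‖ ^ 2 = 1 := by exact_mod_cast h1
  exact (pow_eq_one_iff_of_nonneg (norm_nonneg _) two_ne_zero).1 h2

/-- The overlap of two coherent states: a Gaussian times a phase. -/
theorem inner_coherentState_eq_gaussian_phase {n : ℕ} (z w : EuclideanSpace ℂ (Fin n)) :
    inner ℂ (coherentState z) (coherentState w) =
      Complex.exp (-(‖z - w‖ : ℂ) ^ 2 / 2 + (inner ℂ z w).im * Complex.I) := by
  rw [inner_coherentState]
  congr 1
  have h := norm_sub_sq (𝕜 := ℂ) z w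
  have h' : (‖z - w‖ : ℂ) ^ 2 = ‖z‖ ^ 2 - 2 * (inner ℂ z w).re + ‖w‖ ^ 2 := by exact_mod_cast h
  rw [h']
  nth_rw 1 [← Complex.re_add_im (inner ℂ z w)]
  ring

/-- Up to a phase, the coherent states depend on their label in a 1-Lipschitz way. -/
theorem exists_unit_mul_coherentState_sub_le {n : ℕ} (z w : EuclideanSpace ℂ (Fin n)) :
    ∃ c : ℂ, ‖c‖ = 1 ∧ ‖coherentState z - c • coherentState w‖ ≤ ‖z - w‖ := by
  -- This phase makes the overlap real, so the squared distance is `2 - 2 exp (-‖z - w‖² / 2)`.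
  refine ⟨Complex.exp (-(inner ℂ z w).im * Complex.I), ?_, ?_⟩
  · rw [← Complex.ofReal_neg, Complex.norm_exp_ofReal_mul_I]
  set c := Complex.exp (-(inner ℂ z w).im * Complex.I) with hc
  have hc1 : ‖c‖ = 1 := by rw [hc, ← Complex.ofReal_neg, Complex.norm_exp_ofReal_mul_I]
  refine le_of_sq_le_sq ?_ (norm_nonneg _)
  rw [norm_sub_sq (𝕜 := ℂ), norm_smul, hc1, norm_coherentState, norm_coherentState,
    inner_smul_right, inner_coherentState_eq_gaussian_phase, hc,
    ← Complex.exp_add]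
  have : -(inner ℂ z w).im * Complex.I + (-(‖z - w‖ : ℂ) ^ 2 / 2 + (inner ℂ z w).im * Complex.I)
      = ((-‖z - w‖ ^ 2 / 2 : ℝ) : ℂ) := by push_cast; ring
  rw [this, ← Complex.ofReal_exp]
  have h3 := Real.add_one_le_exp (-‖z - w‖ ^ 2 / 2)
  simp only [RCLike.re_to_complex, Complex.ofReal_re]
  linarith

/-! ### Lipschitz regularity of dual functions -/

theorem norm_expectation_sub_le {H : Type*} [NormedAddCommGroup H] [InnerProductSpace ℂ H]
    (A : H →L[ℂ] H) (u v : H) (hu : ‖u‖ = 1) (hv : ‖v‖ = 1) :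
    ‖inner ℂ u (A u) - inner ℂ v (A v)‖ ≤ 2 * ‖A‖ * ‖u - v‖ := by
  have h : inner ℂ u (A u) - inner ℂ v (A v) =
      inner ℂ (u - v) (A u) + inner ℂ v (A (u - v)) := by
    rw [map_sub, inner_sub_left, inner_sub_right]
    ring
  rw [h]
  refine (norm_add_le _ _).trans ?_
  have h1 : ‖inner ℂ (u - v) (A u)‖ ≤ ‖u - v‖ * (‖A‖ * ‖u‖) :=
    (norm_inner_le_norm _ _).trans (by gcongr; exact A.le_opNorm u)
  have h2 : ‖inner ℂ v (A (u - v))‖ ≤ ‖v‖ * (‖A‖ * ‖u - v‖) :=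
    (norm_inner_le_norm _ _).trans (by gcongr; exact A.le_opNorm _)
  rw [hu] at h1
  rw [hv] at h2
  linarith

theorem norm_coherentState_expectation_sub_le {n : ℕ} (A : FockSpace n →L[ℂ] FockSpace n)
    (z w : EuclideanSpace ℂ (Fin n)) :
    ‖inner ℂ (coherentState z) (A (coherentState z)) -
      inner ℂ (coherentState w) (A (coherentState w))‖ ≤ 2 * ‖A‖ * ‖z - w‖ := by
  obtain ⟨c, hc, h⟩ := exists_unit_mul_coherentState_sub_le z w
  have h1 : inner ℂ (c • coherentState w) (A (c • coherentState w)) =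
      inner ℂ (coherentState w) (A (coherentState w)) := by
    rw [map_smul, inner_smul_left, inner_smul_right, ← mul_assoc, Complex.conj_mul', hc]
    simp
  rw [← h1]
  refine (norm_expectation_sub_le A _ _ (norm_coherentState z) ?_).trans ?_
  · rw [norm_smul, hc, norm_coherentState, one_mul]
  · gcongr

/-- Dual functions are bounded and Lipschitz, hence uniformly continuous. -/
theorem IsDualFunction.isBUC {m n : ℕ}
    {ι : EuclideanSpace ℝ (Fin m) →ₗᵢ[ℝ] EuclideanSpace ℂ (Fin n)}
    {g : EuclideanSpace ℝ (Fin m) → ℝ}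
    (hg : IsDualFunction (fun x => coherentState (ι x)) g) : IsBUC g := by
  obtain ⟨A, -, hA⟩ := hg
  constructor
  · refine ⟨‖A‖, fun x => ?_⟩
    rw [← Real.norm_eq_abs, ← Complex.norm_real, hA]
    refine (norm_inner_le_norm _ _).trans ?_
    rw [norm_coherentState, one_mul]
    simpa [norm_coherentState] using A.le_opNorm (coherentState (ι x))
  · have : LipschitzWith (2 * ‖A‖₊) g := by
      refine LipschitzWith.of_dist_le_mul fun x y => ?_
      rw [dist_eq_norm, dist_eq_norm, ← Complex.norm_real, Complex.ofReal_sub, hA, hA]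
      refine (norm_coherentState_expectation_sub_le A _ _).trans ?_
      rw [← map_sub, ι.norm_map]
      simp
    exact this.uniformContinuous

/-! ### Dual functions from a Gram matrix -/

/-- Families with the same Gram matrix are related by a bounded operator. -/
theorem exists_continuousLinearMap_of_inner_eq {X H K : Type*} [NormedAddCommGroup H]
    [InnerProductSpace ℂ H] [CompleteSpace H] [NormedAddCommGroup K] [InnerProductSpace ℂ K]
    [CompleteSpace K] (ψ : X → H) (φ : X → K)
    (h : ∀ x y, inner ℂ (φ x) (φ y) = inner ℂ (ψ x) (ψ y)) :
    ∃ T : H →L[ℂ] K, ∀ x, T (ψ x) = φ x := by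
  set L := Finsupp.linearCombination ℂ ψ with hL
  set M := Finsupp.linearCombination ℂ φ with hM
  set S : Submodule ℂ H := (LinearMap.range L).topologicalClosure with hS
  have hcomplete : CompleteSpace S :=
    (Submodule.isClosed_topologicalClosure _).completeSpace_coe
  have hmem : ∀ c, L c ∈ S := fun c =>
    Submodule.le_topologicalClosure _ (LinearMap.mem_range_self L c)
  set e : (X →₀ ℂ) →ₗ[ℂ] S := L.codRestrict S hmem with he
  have hdense : DenseRange e := by
    intro v
    rw [closure_subtype]
    have hv : (v : H) ∈ closure (LinearMap.range L : Set H) := v.2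
    convert! hv
    ext w
    constructor
    · rintro ⟨-, ⟨c, rfl⟩, rfl⟩
      exact ⟨c, rfl⟩
    · rintro ⟨c, rfl⟩
      exact ⟨e c, ⟨c, rfl⟩, rfl⟩
  -- Norms of linear combinations depend only on the Gram matrix, so `L c ↦ M c` is a well-defined
  -- isometry; it extends to the closed span and is precomposed with the projection.
  have hnorm : ∀ c, ‖M c‖ = ‖L c‖ := by
    intro c
    rw [@norm_eq_sqrt_re_inner ℂ, @norm_eq_sqrt_re_inner ℂ]
    congr 2
    simp only [hL, hM, Finsupp.linearCombination_apply, Finsupp.sum, sum_inner, inner_sum,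
      inner_smul_left, inner_smul_right, h]
  refine ⟨(M.extendOfNorm e).comp S.orthogonalProjectionOnto, fun x => ?_⟩
  have hx : ψ x = (e (Finsupp.single x 1) : H) := by simp [he, hL]
  rw [ContinuousLinearMap.comp_apply, hx, Submodule.orthogonalProjectionOnto_mem_subspace_eq_self,
    LinearMap.extendOfNorm_eq hdense ⟨1, fun c => ?_⟩]
  · simp [hM]
  · rw [one_mul, hnorm]
    rfl

/-- Compressions of multiplication operators: if the vectors `φ x` of an `L²` space have the same
Gram matrix as the vectors `ψ x`, then integrating a bounded real function against `‖φ x‖²` gives a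
dual function of `ψ`. -/
theorem isDualFunction_integral_of_inner_eq {X Y H : Type*} [NormedAddCommGroup H]
    [InnerProductSpace ℂ H] [CompleteSpace H] [MeasurableSpace Y] {μ : Measure Y} (ψ : X → H)
    (φ : X → Lp ℂ 2 μ) (h : ∀ x y, inner ℂ (φ x) (φ y) = inner ℂ (ψ x) (ψ y))
    {a : Y → ℝ} (ha : AEStronglyMeasurable a μ) {M : ℝ} (haM : ∀ y, |a y| ≤ M) :
    IsDualFunction ψ fun x => ∫ y, a y * ‖φ x y‖ ^ 2 ∂μ := by
  obtain ⟨T, hT⟩ := exists_continuousLinearMap_of_inner_eq ψ φ h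
  have hmem : MemLp (fun y => (a y : ℂ)) ⊤ μ := by
    refine memLp_top_of_bound (Complex.continuous_ofReal.comp_aestronglyMeasurable ha) M
      (Filter.Eventually.of_forall fun y => ?_)
    rw [Complex.norm_real]
    exact haM y
  set B : Lp ℂ 2 μ →L[ℂ] Lp ℂ 2 μ :=
    (ContinuousLinearMap.mul ℂ ℂ).holderL μ ⊤ 2 2 (hmem.toLp _) with hB
  have hBapp : ∀ u : Lp ℂ 2 μ, B u =ᵐ[μ] fun y => (a y : ℂ) * u y := by
    intro u
    filter_upwards [(ContinuousLinearMap.mul ℂ ℂ).coeFn_holder (r := 2) (hmem.toLp _) u,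
      hmem.coeFn_toLp] with y h1 h2
    rw [← h2]
    exact h1
  have hBsa : IsSelfAdjoint B := by
    rw [ContinuousLinearMap.isSelfAdjoint_iff_isSymmetric]
    intro u v
    simp only [ContinuousLinearMap.coe_coe, L2.inner_def]
    refine integral_congr_ae ?_
    filter_upwards [hBapp u, hBapp v] with y h1 h2
    rw [h1, h2]
    simp only [RCLike.inner_apply, map_mul, Complex.conj_ofReal]
    ring
  refine ⟨(ContinuousLinearMap.adjoint T).comp (B.comp T), ?_, fun x => ?_⟩
  · rw [ContinuousLinearMap.isSelfAdjoint_iff_isSymmetric] at hBsa ⊢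
    intro u v
    simp only [ContinuousLinearMap.coe_coe, ContinuousLinearMap.comp_apply,
      ContinuousLinearMap.adjoint_inner_left, ContinuousLinearMap.adjoint_inner_right]
    exact hBsa (T u) (T v)
  · rw [ContinuousLinearMap.comp_apply, ContinuousLinearMap.comp_apply,
      ContinuousLinearMap.adjoint_inner_right, hT, L2.inner_def, ← integral_complex_ofReal]
    refine integral_congr_ae ?_
    filter_upwards [hBapp (φ x)] with y h1
    rw [h1, ← smul_eq_mul (a y : ℂ), inner_smul_right, inner_self_eq_norm_sq_to_K]
    simp

/-! ### Gaussian integrals -/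

section Gaussian

/-- The integral of `exp (-‖v‖²)` over a Euclidean space `V`. -/
def gaussianMass (V : Type*) [NormedAddCommGroup V] [InnerProductSpace ℝ V] : ℝ :=
  Real.pi ^ (Module.finrank ℝ V / 2 : ℝ)

theorem gaussianMass_pos {V : Type*} [NormedAddCommGroup V] [InnerProductSpace ℝ V] :
    0 < gaussianMass V := by
  unfold gaussianMass
  positivity

variable {V : Type*} [NormedAddCommGroup V] [InnerProductSpace ℝ V] [FiniteDimensional ℝ V]
  [MeasurableSpace V] [BorelSpace V]

theorem integral_cexp_neg_sq_norm_add_I (w : V) :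
    ∫ v : V, Complex.exp (-(‖v‖ : ℂ) ^ 2 + Complex.I * (inner ℝ w v : ℝ)) =
      gaussianMass V * Complex.exp (-(‖w‖ : ℂ) ^ 2 / 4) := by
  have h := GaussianFourier.integral_cexp_neg_mul_sq_norm_add (b := 1) (by simp) Complex.I w
  have h1 : ((Real.pi : ℂ) / 1) ^ ((Module.finrank ℝ V : ℂ) / 2) = gaussianMass V := by
    rw [gaussianMass, Complex.ofReal_cpow Real.pi_pos.le]
    simp
  rw [h1] at h
  simpa using h

theorem integrable_exp_neg_sq_norm_sub (x : V) :
    Integrable fun v : V => Real.exp (-‖v - x‖ ^ 2) := by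
  have h := (GaussianFourier.integrable_cexp_neg_mul_sq_norm_add (V := V) (b := 1)
    (by simp) 0 0).norm
  have h' : Integrable fun v : V => Real.exp (-‖v‖ ^ 2) := by
    refine h.congr (Filter.Eventually.of_forall fun v => ?_)
    simp only [Complex.norm_exp]
    congr 1
    simp [-Complex.ofReal_pow, ← Complex.ofReal_pow]
  exact h'.comp_sub_right x

end Gaussian

/-! ### Wave packets and the Husimi transform -/

section WavePacket

variable {n : ℕ}

/-- A Gaussian wave packet on phase space centred at `x`. -/
def wavePacket (x z : EuclideanSpace ℂ (Fin n)) : ℂ :=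
  Complex.exp (-(‖z - x‖ : ℂ) ^ 2 / 2 + (inner ℂ z x).im * Complex.I)

theorem real_inner_euclideanSpace (z w : EuclideanSpace ℂ (Fin n)) :
    inner ℝ z w = (inner ℂ z w).re := by
  simp only [PiLp.inner_apply, Complex.re_sum]
  rfl

theorem norm_wavePacket_sq (x z : EuclideanSpace ℂ (Fin n)) :
    ‖wavePacket x z‖ ^ 2 = Real.exp (-‖z - x‖ ^ 2) := by
  rw [wavePacket, Complex.norm_exp, ← Real.exp_nat_mul]
  congr 1
  simp [-Complex.ofReal_pow, ← Complex.ofReal_pow]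
  ring

theorem continuous_wavePacket (x : EuclideanSpace ℂ (Fin n)) : Continuous (wavePacket x) := by
  unfold wavePacket
  fun_prop

theorem memLp_wavePacket (x : EuclideanSpace ℂ (Fin n)) : MemLp (wavePacket x) 2 := by
  rw [memLp_two_iff_integrable_sq_norm (continuous_wavePacket x).aestronglyMeasurable]
  simp only [norm_wavePacket_sq]
  exact integrable_exp_neg_sq_norm_sub x

theorem im_inner_midpoint_sub (x y : EuclideanSpace ℂ (Fin n)) :
    (inner ℂ ((1 / 2 : ℂ) • (x + y)) (y - x)).im = (inner ℂ x y).im := by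
  have h1 : (inner ℂ x x : ℂ).im = 0 := inner_self_im (𝕜 := ℂ) x
  have h2 : (inner ℂ y y : ℂ).im = 0 := inner_self_im (𝕜 := ℂ) y
  have h3 : (inner ℂ y x : ℂ).im = -(inner ℂ x y).im := by
    rw [← inner_conj_symm, Complex.conj_im]
  rw [inner_smul_left, inner_add_left, inner_sub_right, inner_sub_right]
  have : (starRingEnd ℂ) (1 / 2 : ℂ) = ((1 / 2 : ℝ) : ℂ) := by
    rw [← Complex.conj_ofReal]
    simp
  rw [this, Complex.im_ofReal_mul]
  simp only [Complex.add_im, Complex.sub_im, h1, h2, h3]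
  ring

/-- Centring at the midpoint of `x` and `y` lets the parallelogram law remove the cross terms,
leaving a centred Gaussian times a character. Integrating it supplies a second factor `exp (-‖x -
y‖² / 4)`, which completes the coherent overlap. -/
theorem conj_wavePacket_mul (x y z : EuclideanSpace ℂ (Fin n)) :
    inner ℂ (wavePacket x (z + (1 / 2 : ℂ) • (x + y))) (wavePacket y (z + (1 / 2 : ℂ) • (x + y))) =
      Complex.exp (-(‖x - y‖ : ℂ) ^ 2 / 4 + (inner ℂ x y).im * Complex.I) *
      Complex.exp (-(‖z‖ : ℂ) ^ 2 +
        Complex.I * (inner ℝ (-Complex.I • (y - x)) z : ℝ)) := by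
  set m := (1 / 2 : ℂ) • (x + y) with hm
  set d := (1 / 2 : ℂ) • (y - x) with hd
  have e1 : z + m - x = z + d := by rw [hm, hd]; module
  have e2 : z + m - y = z - d := by rw [hm, hd]; module
  have hp := parallelogram_law_with_norm ℂ z d
  have hdn : ‖d‖ = ‖x - y‖ / 2 := by
    rw [hd, norm_smul, norm_sub_rev]
    simp
    ring
  rw [hdn] at hp
  have hp' : (‖z + d‖ : ℂ) ^ 2 + (‖z - d‖ : ℂ) ^ 2 = 2 * ‖z‖ ^ 2 + ‖x - y‖ ^ 2 / 2 := by
    have : ‖z + d‖ ^ 2 + ‖z - d‖ ^ 2 = 2 * ‖z‖ ^ 2 + ‖x - y‖ ^ 2 / 2 := by linarith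
    exact_mod_cast this
  have hi : (inner ℂ (z + m) y).im - (inner ℂ (z + m) x).im =
      (inner ℝ (-Complex.I • (y - x)) z : ℝ) + (inner ℂ x y).im := by
    rw [← Complex.sub_im, ← inner_sub_right, inner_add_left, Complex.add_im, hm,
      im_inner_midpoint_sub, real_inner_euclideanSpace, inner_smul_left]
    have : (inner ℂ z (y - x) : ℂ).im = -(inner ℂ (y - x) z).im := by
      rw [← inner_conj_symm, Complex.conj_im]
    rw [this, map_neg, Complex.conj_I, neg_neg, Complex.I_mul_re]
  have hi' : ((inner ℂ (z + m) y).im : ℂ) - ((inner ℂ (z + m) x).im : ℂ) =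
      ((inner ℝ (-Complex.I • (y - x)) z : ℝ) : ℂ) + ((inner ℂ x y).im : ℂ) := by
    exact_mod_cast hi
  rw [RCLike.inner_apply, wavePacket, wavePacket, ← Complex.exp_conj, ← Complex.exp_add,
    ← Complex.exp_add, e1, e2]
  congr 1
  simp only [map_add, map_mul, map_div₀, map_neg, map_pow, Complex.conj_ofReal, Complex.conj_I,
    Complex.conj_ofNat]
  linear_combination (-1 / 2 : ℂ) * hp' + Complex.I * hi'

/-- The wave packets realize the Gram matrix of the coherent states in `L²` of phase space. -/
theorem integral_inner_wavePacket (x y : EuclideanSpace ℂ (Fin n)) :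
    ∫ z, inner ℂ (wavePacket x z) (wavePacket y z) =
      gaussianMass (EuclideanSpace ℂ (Fin n)) *
        inner ℂ (coherentState x) (coherentState y) := by
  rw [← integral_add_right_eq_self _ ((1 / 2 : ℂ) • (x + y))]
  simp only [conj_wavePacket_mul]
  rw [integral_const_mul, integral_cexp_neg_sq_norm_add_I, inner_coherentState_eq_gaussian_phase,
    mul_left_comm, ← Complex.exp_add]
  congr 2
  rw [norm_smul, norm_sub_rev y x]
  simp
  ring

/-- The Husimi transform of a bounded symbol: smoothing with the Gaussian `exp (-‖z‖²)` gives a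
dual function of the coherent states. -/
theorem isDualFunction_coherentState_integral {a : EuclideanSpace ℂ (Fin n) → ℝ}
    (ha : AEStronglyMeasurable a) {M : ℝ} (haM : ∀ z, |a z| ≤ M) :
    IsDualFunction (coherentState (n := n)) fun x =>
      (gaussianMass (EuclideanSpace ℂ (Fin n)))⁻¹ *
        ∫ z, a (x + z) * Real.exp (-‖z‖ ^ 2) := by
  set C := gaussianMass (EuclideanSpace ℂ (Fin n)) with hC
  have hCpos : 0 < C := gaussianMass_pos
  set φ : EuclideanSpace ℂ (Fin n) → Lp ℂ 2 (volume : Measure (EuclideanSpace ℂ (Fin n))) :=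
    fun x => ((Real.sqrt C)⁻¹ : ℂ) • (memLp_wavePacket x).toLp with hφ
  have hs : ((Real.sqrt C)⁻¹ : ℂ) * ((Real.sqrt C)⁻¹ : ℂ) = (C : ℂ)⁻¹ := by
    rw [← mul_inv, ← Complex.ofReal_mul, Real.mul_self_sqrt hCpos.le]
  have hgram : ∀ x y, inner ℂ (φ x) (φ y) = inner ℂ (coherentState x) (coherentState y) := by
    intro x y
    have : inner ℂ (memLp_wavePacket x).toLp (memLp_wavePacket y).toLp =
        ∫ z, inner ℂ (wavePacket x z) (wavePacket y z) := by
      rw [L2.inner_def]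
      refine integral_congr_ae ?_
      filter_upwards [(memLp_wavePacket x).coeFn_toLp, (memLp_wavePacket y).coeFn_toLp]
        with z h1 h2
      rw [h1, h2]
    rw [hφ, inner_smul_left, inner_smul_right, this, integral_inner_wavePacket, map_inv₀,
      Complex.conj_ofReal, ← mul_assoc, ← mul_assoc, hs, inv_mul_cancel₀, one_mul]
    exact_mod_cast hCpos.ne'
  obtain ⟨A, hA, h⟩ := isDualFunction_integral_of_inner_eq _ φ hgram ha haM
  refine ⟨A, hA, fun x => ?_⟩
  rw [← h x]
  congr 1
  have hae : ∀ᵐ z, ‖φ x z‖ ^ 2 = C⁻¹ * Real.exp (-‖z - x‖ ^ 2) := by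
    filter_upwards [(memLp_wavePacket x).coeFn_toLp,
      Lp.coeFn_smul ((Real.sqrt C)⁻¹ : ℂ) (memLp_wavePacket x).toLp] with z h1 h2
    rw [hφ, h2, Pi.smul_apply, h1, norm_smul, mul_pow, norm_wavePacket_sq, norm_inv,
      Complex.norm_real, Real.norm_eq_abs, inv_pow, sq_abs, Real.sq_sqrt hCpos.le]
  have h1 : ∫ z, a z * ‖φ x z‖ ^ 2 = ∫ z, a z * (C⁻¹ * Real.exp (-‖z - x‖ ^ 2)) := by
    refine integral_congr_ae ?_
    filter_upwards [hae] with z hz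
    rw [hz]
  beta_reduce
  rw [h1, ← integral_add_left_eq_self (fun z => a z * (C⁻¹ * Real.exp (-‖z - x‖ ^ 2))) x,
    ← integral_const_mul]
  refine integral_congr_ae (Filter.Eventually.of_forall fun z => ?_)
  simp only [add_sub_cancel_left]
  ring

end WavePacket

/-! ### Convolution of bounded continuous functions with integrable kernels -/

section Convolution

variable {m : ℕ}

theorem norm_mul_translate_integral_le {F φ : EuclideanSpace ℝ (Fin m) → ℂ} {M : ℝ}
    (hFM : ∀ y, ‖F y‖ ≤ M) (hφ : Integrable φ) (x : EuclideanSpace ℝ (Fin m)) :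
    ∫ y, ‖F y * φ (x - y)‖ ≤ M * ∫ y, ‖φ y‖ := by
  rw [← integral_sub_left_eq_self (fun y => ‖φ y‖) volume x, ← integral_const_mul]
  refine integral_mono_of_nonneg (Filter.Eventually.of_forall fun y => norm_nonneg _)
    ((hφ.comp_sub_left x).norm.const_mul M) (Filter.Eventually.of_forall fun y => ?_)
  simp only [norm_mul]
  gcongr
  exact hFM y

theorem norm_integral_mul_translate_le {F φ : EuclideanSpace ℝ (Fin m) → ℂ} {M : ℝ}
    (hFM : ∀ y, ‖F y‖ ≤ M) (hφ : Integrable φ) (x : EuclideanSpace ℝ (Fin m)) :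
    ‖∫ y, F y * φ (x - y)‖ ≤ M * ∫ y, ‖φ y‖ :=
  (norm_integral_le_integral_norm _).trans (norm_mul_translate_integral_le hFM hφ x)

theorem integrable_mul_translate {F φ : EuclideanSpace ℝ (Fin m) → ℂ} {M : ℝ}
    (hF : Continuous F) (hFM : ∀ y, ‖F y‖ ≤ M) (hφ : Integrable φ)
    (x : EuclideanSpace ℝ (Fin m)) : Integrable fun y => F y * φ (x - y) :=
  (hφ.comp_sub_left x).bdd_mul hF.aestronglyMeasurable (Filter.Eventually.of_forall hFM)

theorem continuous_integral_mul_translate {F φ : EuclideanSpace ℝ (Fin m) → ℂ} {M : ℝ}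
    (hF : Continuous F) (hFM : ∀ y, ‖F y‖ ≤ M) (hφ : Integrable φ) :
    Continuous fun x => ∫ y, F y * φ (x - y) := by
  -- The substitution moves `x` from `φ`, only integrable, to `F`, continuous and bounded, so
  -- domination applies.
  have h : (fun x => ∫ y, F y * φ (x - y)) = fun x => ∫ y, F (x - y) * φ y := by
    ext x
    rw [← integral_sub_left_eq_self _ volume x]
    simp
  rw [h]
  refine continuous_of_dominated (bound := fun y => M * ‖φ y‖) (fun x => ?_) (fun x => ?_)
    (hφ.norm.const_mul M) ?_
  · exact (hF.comp (by fun_prop : Continuous fun y => x - y)).aestronglyMeasurable.mul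
      hφ.aestronglyMeasurable
  · refine Filter.Eventually.of_forall fun y => ?_
    rw [norm_mul]
    gcongr
    exact hFM _
  · exact Filter.Eventually.of_forall fun y => by fun_prop

/-- Fubini for a bounded continuous function convolved with `φ` and averaged over translates. -/
theorem integrable_prod_mul_translate {Z : Type*} [MeasurableSpace Z] {μ : Measure Z} [SFinite μ]
    {F φ : EuclideanSpace ℝ (Fin m) → ℂ} {M : ℝ} (hF : Continuous F) (hFM : ∀ y, ‖F y‖ ≤ M)
    (hφc : Continuous φ) (hφ : Integrable φ) {g : Z → ℂ} (hg : Integrable g μ)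
    {w : Z → EuclideanSpace ℝ (Fin m)} (hw : Measurable w) :
    Integrable (fun p : Z × EuclideanSpace ℝ (Fin m) => F p.2 * φ (w p.1 - p.2) * g p.1)
      (μ.prod volume) := by
  have hmeas : AEStronglyMeasurable
      (fun p : Z × EuclideanSpace ℝ (Fin m) => F p.2 * φ (w p.1 - p.2) * g p.1)
      (μ.prod volume) := by
    refine AEStronglyMeasurable.mul (AEStronglyMeasurable.mul ?_ ?_)
      hg.aestronglyMeasurable.comp_fst
    · exact (hF.measurable.comp measurable_snd).aestronglyMeasurable
    · exact (hφc.measurable.comp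
        ((hw.comp measurable_fst).sub measurable_snd)).aestronglyMeasurable
  rw [integrable_prod_iff hmeas]
  constructor
  · exact Filter.Eventually.of_forall fun z =>
      (integrable_mul_translate hF hFM hφ (w z)).mul_const (g z)
  · refine (hg.norm.const_mul (M * ∫ y, ‖φ y‖)).mono' hmeas.norm.integral_prod_right'
      (Filter.Eventually.of_forall fun z => ?_)
    rw [Real.norm_of_nonneg (integral_nonneg fun y => norm_nonneg _)]
    simp only [norm_mul _ (g z)]
    rw [integral_mul_const]
    gcongr
    exact norm_mul_translate_integral_le hFM hφ (w z)

/-- Used twice: with `w z = x + P z` to shift Gaussian smoothing onto the kernel, and with `w = id`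
to shift a convolution onto a test function. -/
theorem integral_integral_mul_translate {Z : Type*} [MeasurableSpace Z] {μ : Measure Z} [SFinite μ]
    {F φ : EuclideanSpace ℝ (Fin m) → ℂ} {M : ℝ} (hF : Continuous F) (hFM : ∀ y, ‖F y‖ ≤ M)
    (hφc : Continuous φ) (hφ : Integrable φ) {g : Z → ℂ} (hg : Integrable g μ)
    {w : Z → EuclideanSpace ℝ (Fin m)} (hw : Measurable w) :
    ∫ z, (∫ y, F y * φ (w z - y)) * g z ∂μ = ∫ y, F y * ∫ z, φ (w z - y) * g z ∂μ := by
  simp_rw [← integral_mul_const, ← integral_const_mul]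
  rw [integral_integral_swap (integrable_prod_mul_translate hF hFM hφc hφ hg hw)]
  simp only [mul_assoc]

end Convolution

/-! ### Inverting Gaussian smoothing -/

section Fourier

variable {m n : ℕ}

/-- Multiplication by `exp (π² ‖ξ‖²)` on the Fourier side inverts Gaussian smoothing. -/
theorem integral_fourierInv_translate_gaussian
    (ι : EuclideanSpace ℝ (Fin m) →ₗᵢ[ℝ] EuclideanSpace ℂ (Fin n))
    {χ : EuclideanSpace ℝ (Fin m) → ℂ}
    (hψ : Integrable fun ξ => χ ξ * Complex.exp ((Real.pi : ℂ) ^ 2 * (‖ξ‖ : ℂ) ^ 2))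
    (v : EuclideanSpace ℝ (Fin m)) :
    ∫ z : EuclideanSpace ℂ (Fin n),
      𝓕⁻ (fun ξ => χ ξ * Complex.exp ((Real.pi : ℂ) ^ 2 * (‖ξ‖ : ℂ) ^ 2))
        (v + ContinuousLinearMap.adjoint ι.toContinuousLinearMap z) *
          (Real.exp (-‖z‖ ^ 2) : ℂ) =
      gaussianMass (EuclideanSpace ℂ (Fin n)) * 𝓕⁻ χ v := by
  set ψ := fun ξ => χ ξ * Complex.exp ((Real.pi : ℂ) ^ 2 * (‖ξ‖ : ℂ) ^ 2) with hψdef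
  set P := ContinuousLinearMap.adjoint ι.toContinuousLinearMap with hP
  have hg : Integrable fun z : EuclideanSpace ℂ (Fin n) => (Real.exp (-‖z‖ ^ 2) : ℂ) := by
    have := integrable_exp_neg_sq_norm_sub (0 : EuclideanSpace ℂ (Fin n))
    simp only [sub_zero] at this
    exact this.ofReal
  simp_rw [Real.fourierInv_eq', ← integral_mul_const, smul_eq_mul]
  rw [integral_integral_swap, ← integral_const_mul]
  · congr 1
    ext ξ
    have h1 : ∀ z : EuclideanSpace ℂ (Fin n),
        Complex.exp (((2 * Real.pi * inner ℝ ξ (v + P z) : ℝ) : ℂ) * Complex.I) * ψ ξ *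
          (Real.exp (-‖z‖ ^ 2) : ℂ) =
        Complex.exp (((2 * Real.pi * inner ℝ ξ v : ℝ) : ℂ) * Complex.I) * ψ ξ *
          Complex.exp (-(‖z‖ : ℂ) ^ 2 +
            Complex.I * (inner ℝ ((2 * Real.pi) • ι ξ) z : ℝ)) := by
      intro z
      have e1 : inner ℝ ξ (P z) = inner ℝ (ι ξ) z := by
        rw [hP, ContinuousLinearMap.adjoint_inner_right]
        rfl
      rw [inner_add_right, e1, real_inner_smul_left, Complex.ofReal_exp, mul_right_comm,
        mul_right_comm _ (ψ ξ), ← Complex.exp_add, ← Complex.exp_add]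
      congr 2
      push_cast
      ring
    simp_rw [h1]
    rw [integral_const_mul, integral_cexp_neg_sq_norm_add_I, norm_smul, ι.norm_map, hψdef]
    -- The Gaussian transform at frequency `2π ι ξ` is `exp (-4π² ‖ξ‖² / 4)`, cancelled by the
    -- factor in `ψ`.
    have h2 : Complex.exp ((Real.pi : ℂ) ^ 2 * (‖ξ‖ : ℂ) ^ 2) *
        Complex.exp (-((‖(2 * Real.pi : ℝ)‖ * ‖ξ‖ : ℝ) : ℂ) ^ 2 / 4) = 1 := by
      rw [← Complex.exp_add, Complex.exp_eq_one_iff]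
      refine ⟨0, ?_⟩
      rw [Real.norm_of_nonneg (by positivity)]
      push_cast
      ring
    linear_combination
      (Complex.exp (((2 * Real.pi * inner ℝ ξ v : ℝ) : ℂ) * Complex.I) * χ ξ *
        gaussianMass (EuclideanSpace ℂ (Fin n))) * h2
  · have hprod := hg.mul_prod hψ
    refine hprod.mono ?_ (Filter.Eventually.of_forall fun p => ?_)
    · refine AEStronglyMeasurable.mul (AEStronglyMeasurable.mul ?_ ?_) ?_
      · refine Continuous.aestronglyMeasurable ?_
        fun_prop
      · exact hψ.aestronglyMeasurable.comp_snd
      · exact hg.aestronglyMeasurable.comp_fst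
    · simp only [Function.uncurry, norm_mul, Complex.norm_exp_ofReal_mul_I, one_mul]
      rw [mul_comm]

end Fourier

/-! ### Band-limited functions are dual functions -/

section BandLimited

variable {m n : ℕ}

/-- Convolving with a kernel of compactly supported Fourier transform gives a dual function. -/
theorem isDualFunction_re_integral_mul_fourierInv
    (ι : EuclideanSpace ℝ (Fin m) →ₗᵢ[ℝ] EuclideanSpace ℂ (Fin n))
    {f : EuclideanSpace ℝ (Fin m) → ℝ} (hf : Continuous f) {M : ℝ} (hfM : ∀ x, |f x| ≤ M)
    {χ : EuclideanSpace ℝ (Fin m) → ℂ} (hχ : HasCompactSupport χ) (hχs : ContDiff ℝ ∞ χ) :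
    IsDualFunction (fun x => coherentState (ι x))
      fun x => (∫ y, (f y : ℂ) * 𝓕⁻ χ (x - y)).re := by
  set ψ : EuclideanSpace ℝ (Fin m) → ℂ :=
    fun ξ => χ ξ * Complex.exp ((Real.pi : ℂ) ^ 2 * (‖ξ‖ : ℂ) ^ 2) with hψ
  have hψc : HasCompactSupport ψ := hχ.mul_right
  have hψs : ContDiff ℝ ∞ ψ := by
    refine hχs.mul (Complex.contDiff_exp.comp (contDiff_const.mul ?_))
    have h : ContDiff ℝ ∞ fun ξ : EuclideanSpace ℝ (Fin m) => ((‖ξ‖ ^ 2 : ℝ) : ℂ) :=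
      Complex.ofRealCLM.contDiff.comp (contDiff_norm_sq ℝ)
    simpa using h
  set φ : 𝓢(EuclideanSpace ℝ (Fin m), ℂ) := 𝓕⁻ (hψc.toSchwartzMap hψs) with hφ
  have hφψ : ∀ v, φ v = 𝓕⁻ ψ v := fun v => by
    rw [hφ, SchwartzMap.fourierInv_coe]
    rfl
  have hψi : Integrable ψ := hψs.continuous.integrable_of_hasCompactSupport hψc
  have hF : Continuous fun y => (f y : ℂ) := Complex.continuous_ofReal.comp hf
  have hFM : ∀ y, ‖(f y : ℂ)‖ ≤ M := fun y => by
    rw [Complex.norm_real]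
    exact hfM y
  set α := fun x => ∫ y, (f y : ℂ) * φ (x - y) with hα
  have hαc : Continuous α := continuous_integral_mul_translate hF hFM φ.integrable
  have hαM : ∀ x, ‖α x‖ ≤ M * ∫ y, ‖φ y‖ := norm_integral_mul_translate_le hFM φ.integrable
  set P := ContinuousLinearMap.adjoint ι.toContinuousLinearMap with hP
  have hPι : ∀ x, P (ι x) = x := fun x => by
    refine ext_inner_left ℝ fun v => ?_
    rw [hP, ContinuousLinearMap.adjoint_inner_right]
    exact ι.inner_map_map v x
  have hg : Integrable fun z : EuclideanSpace ℂ (Fin n) => (Real.exp (-‖z‖ ^ 2) : ℂ) := by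
    have := integrable_exp_neg_sq_norm_sub (0 : EuclideanSpace ℂ (Fin n))
    simp only [sub_zero] at this
    exact this.ofReal
  obtain ⟨A, hA, h⟩ := isDualFunction_coherentState_integral (a := fun z => (α (P z)).re)
    (Complex.continuous_re.comp (hαc.comp P.continuous)).aestronglyMeasurable
    (fun z => (Complex.abs_re_le_norm _).trans (hαM _))
  refine ⟨A, hA, fun x => ?_⟩
  rw [← h (ι x)]
  congr 1
  have key : ∫ z : EuclideanSpace ℂ (Fin n), α (x + P z) * (Real.exp (-‖z‖ ^ 2) : ℂ) =
      gaussianMass (EuclideanSpace ℂ (Fin n)) * ∫ y, (f y : ℂ) * 𝓕⁻ χ (x - y) := by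
    rw [hα, integral_integral_mul_translate hF hFM φ.continuous φ.integrable hg
      (w := fun z => x + P z) (by fun_prop), ← integral_const_mul]
    congr 1
    ext y
    have h1 := integral_fourierInv_translate_gaussian ι hψi (x - y)
    rw [mul_left_comm, ← h1]
    congr 2
    ext z
    rw [hφψ, add_sub_right_comm]
  have hint : Integrable fun z : EuclideanSpace ℂ (Fin n) =>
      α (x + P z) * (Real.exp (-‖z‖ ^ 2) : ℂ) :=
    hg.bdd_mul (hαc.comp (by fun_prop)).aestronglyMeasurable
      (Filter.Eventually.of_forall fun z => hαM _)
  have hre := integral_re hint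
  rw [key] at hre
  have hC : gaussianMass (EuclideanSpace ℂ (Fin n)) ≠ 0 := gaussianMass_pos.ne'
  beta_reduce
  simp only [map_add, hPι]
  have hre' : ∫ z : EuclideanSpace ℂ (Fin n), (α (x + P z)).re * Real.exp (-‖z‖ ^ 2) =
      gaussianMass (EuclideanSpace ℂ (Fin n)) * (∫ y, (f y : ℂ) * 𝓕⁻ χ (x - y)).re := by
    rw [← Complex.re_ofReal_mul]
    refine Eq.trans ?_ hre
    congr 1
    ext z
    exact (Complex.re_mul_ofReal _ _).symm
  rw [hre', inv_mul_cancel_left₀ hC]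

/-- Cutting off the spectrum of a test function is convolution with the reflected kernel; this
transfers the cutoff from `f` to `η`. -/
theorem fourier_mul_fourierInv_apply {χ η : EuclideanSpace ℝ (Fin m) → ℂ} (hχ : Integrable χ)
    (hη : Integrable η) (x : EuclideanSpace ℝ (Fin m)) :
    𝓕 (fun ξ => χ ξ * 𝓕⁻ η ξ) x = ∫ y, 𝓕⁻ χ (y - x) * η y := by
  simp_rw [Real.fourier_eq', Real.fourierInv_eq', smul_eq_mul, ← integral_const_mul,
    ← integral_mul_const]
  rw [integral_integral_swap]
  · congr 1
    ext y
    congr 1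
    ext ξ
    have : Complex.exp (((2 * Real.pi * inner ℝ ξ (y - x) : ℝ) : ℂ) * Complex.I) =
        Complex.exp (((-2 * Real.pi * inner ℝ ξ x : ℝ) : ℂ) * Complex.I) *
        Complex.exp (((2 * Real.pi * inner ℝ y ξ : ℝ) : ℂ) * Complex.I) := by
      rw [← Complex.exp_add, inner_sub_right, real_inner_comm y ξ]
      congr 1
      push_cast
      ring
    rw [this]
    ring
  · refine (hχ.mul_prod hη).mono ?_ (Filter.Eventually.of_forall fun p => ?_)
    · refine AEStronglyMeasurable.mul ?_ (AEStronglyMeasurable.mul ?_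
        (AEStronglyMeasurable.mul ?_ ?_))
      · refine Continuous.aestronglyMeasurable ?_
        fun_prop
      · exact hχ.aestronglyMeasurable.comp_fst
      · refine Continuous.aestronglyMeasurable ?_
        fun_prop
      · exact hη.aestronglyMeasurable.comp_snd
    · simp only [Function.uncurry, norm_mul, Complex.norm_exp_ofReal_mul_I, one_mul]
      exact le_rfl

theorem exists_bump_eq_one {K : Set (EuclideanSpace ℝ (Fin m))} (hK : IsCompact K) :
    ∃ χ : EuclideanSpace ℝ (Fin m) → ℂ, HasCompactSupport χ ∧ ContDiff ℝ ∞ χ ∧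
      ∃ U : Set (EuclideanSpace ℝ (Fin m)), IsOpen U ∧ K ⊆ U ∧ ∀ ξ ∈ U, χ ξ = 1 := by
  obtain ⟨R, hR, hKR⟩ := hK.isBounded.subset_ball_lt 0 0
  let b : ContDiffBump (0 : EuclideanSpace ℝ (Fin m)) := ⟨R, R + 1, hR, by linarith⟩
  refine ⟨fun ξ => (b ξ : ℂ), b.hasCompactSupport.comp_left (g := Complex.ofReal) (by simp),
    Complex.ofRealCLM.contDiff.comp b.contDiff, Metric.ball 0 R, Metric.isOpen_ball, hKR,
    fun ξ hξ => ?_⟩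
  beta_reduce
  rw [b.one_of_mem_closedBall (Metric.ball_subset_closedBall hξ), Complex.ofReal_one]

/-- A band-limited function is reproduced by convolution with a band-limited Schwartz kernel. -/
theorem IsBandLimited.eq_integral_mul_fourierInv {f : EuclideanSpace ℝ (Fin m) → ℝ}
    (hf : Continuous f) {M : ℝ} (hfM : ∀ x, |f x| ≤ M) (hb : IsBandLimited f) :
    ∃ χ : EuclideanSpace ℝ (Fin m) → ℂ, HasCompactSupport χ ∧ ContDiff ℝ ∞ χ ∧
      ∀ x, (f x : ℂ) = ∫ y, (f y : ℂ) * 𝓕⁻ χ (x - y) := by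
  obtain ⟨hmem, K, hK, hvan⟩ := hb
  obtain ⟨χ, hχc, hχs, U, hU, hKU, hχU⟩ := exists_bump_eq_one hK
  refine ⟨χ, hχc, hχs, ?_⟩
  have hF : Continuous fun y => (f y : ℂ) := Complex.continuous_ofReal.comp hf
  have hFM : ∀ y, ‖(f y : ℂ)‖ ≤ M := fun y => by
    rw [Complex.norm_real]
    exact hfM y
  have hχi : Integrable χ := hχs.continuous.integrable_of_hasCompactSupport hχc
  set h : 𝓢(EuclideanSpace ℝ (Fin m), ℂ) := 𝓕⁻ (hχc.toSchwartzMap hχs) with hh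
  have hhχ : ∀ v, h v = 𝓕⁻ χ v := fun v => by
    rw [hh, SchwartzMap.fourierInv_coe]
    rfl
  have hT : ∀ u : 𝓢(EuclideanSpace ℝ (Fin m), ℂ), tsupport u ⊆ Kᶜ →
      ∫ x, 𝓕 u x * (f x : ℂ) = 0 := by
    intro u hu
    have h1 := hvan u hu
    rw [TemperedDistribution.fourier_apply, Lp.toTemperedDistribution_apply] at h1
    rw [← h1]
    refine integral_congr_ae ?_
    filter_upwards [hmem.coeFn_toLp] with x hx
    rw [hx, smul_eq_mul]
  have hG : Continuous fun x => ∫ y, (f y : ℂ) * h (x - y) :=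
    continuous_integral_mul_translate hF hFM h.integrable
  have hae : ∀ᵐ x, (f x : ℂ) = ∫ y, (f y : ℂ) * h (x - y) := by
    refine ae_eq_of_integral_contDiff_smul_eq hF.locallyIntegrable hG.locallyIntegrable
      fun η hηs hηc => ?_
    have hηs' : ContDiff ℝ ∞ fun x => (η x : ℂ) := Complex.ofRealCLM.contDiff.comp hηs
    have hηc' : HasCompactSupport fun x => (η x : ℂ) :=
      hηc.comp_left (g := Complex.ofReal) (by simp)
    set ηS : 𝓢(EuclideanSpace ℝ (Fin m), ℂ) := hηc'.toSchwartzMap hηs' with hηS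
    have hηi : Integrable fun x => (η x : ℂ) :=
      hηs'.continuous.integrable_of_hasCompactSupport hηc'
    set θ : 𝓢(EuclideanSpace ℝ (Fin m), ℂ) := 𝓕⁻ ηS with hθ
    have hχθc : HasCompactSupport fun ξ => χ ξ * θ ξ := hχc.mul_right
    have hχθs : ContDiff ℝ ∞ fun ξ => χ ξ * θ ξ := hχs.mul (θ.smooth ⊤)
    set ρ : 𝓢(EuclideanSpace ℝ (Fin m), ℂ) := hχθc.toSchwartzMap hχθs with hρ
    -- `θ - ρ = (1 - χ) θ` vanishes on the open set `U`, so even its closed support avoids `K`, and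
    -- the transform of `f` annihilates it.
    have hsupp : tsupport (θ - ρ : 𝓢(EuclideanSpace ℝ (Fin m), ℂ)) ⊆ Kᶜ := by
      have : tsupport (θ - ρ : 𝓢(EuclideanSpace ℝ (Fin m), ℂ)) ⊆ Uᶜ := by
        refine closure_minimal (fun ξ hξ hξU => hξ ?_) hU.isClosed_compl
        change θ ξ - χ ξ * θ ξ = 0
        rw [hχU ξ hξU]
        ring
      exact this.trans (Set.compl_subset_compl.2 hKU)
    have h1 := hT _ hsupp
    have hη𝓕 : ∀ x, 𝓕 (θ - ρ : 𝓢(EuclideanSpace ℝ (Fin m), ℂ)) x =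
        (η x : ℂ) - ∫ y, h (y - x) * (η y : ℂ) := by
      intro x
      rw [sub_eq_add_neg, FourierTransform.fourier_add, FourierTransform.fourier_neg, hθ,
        FourierTransform.fourier_fourierInv_eq, ← sub_eq_add_neg]
      change (η x : ℂ) - 𝓕 ρ x = _
      congr 1
      rw [SchwartzMap.fourier_coe]
      have h2 := fourier_mul_fourierInv_apply hχi hηi x
      simp only [← hhχ] at h2
      have h3 : (ρ : EuclideanSpace ℝ (Fin m) → ℂ) =
          fun ξ => χ ξ * 𝓕⁻ (fun x => (η x : ℂ)) ξ := by
        ext ξ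
        change χ ξ * θ ξ = _
        rw [hθ, SchwartzMap.fourierInv_coe]
        rfl
      rw [← h2, h3]
    simp_rw [hη𝓕, sub_mul] at h1
    have hswap : ∫ x, (∫ y, h (y - x) * (η y : ℂ)) * (f x : ℂ) =
        ∫ y, (∫ x, (f x : ℂ) * h (y - x)) * (η y : ℂ) := by
      refine Eq.trans ?_ (integral_integral_mul_translate hF hFM h.continuous h.integrable hηi
        (w := fun z => z) measurable_id).symm
      simp only [mul_comm]
    have hi1 : Integrable fun x => (η x : ℂ) * (f x : ℂ) :=
      hηi.mul_bdd hF.aestronglyMeasurable (Filter.Eventually.of_forall hFM)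
    have hi2 : Integrable fun x => (∫ y, h (y - x) * (η y : ℂ)) * (f x : ℂ) := by
      have := (integrable_prod_mul_translate hF hFM h.continuous h.integrable hηi
        measurable_id).integral_prod_right
      refine this.congr (Filter.Eventually.of_forall fun x => ?_)
      simp only [id]
      rw [← integral_mul_const]
      congr 1
      ext y
      ring
    rw [integral_sub hi1 hi2, hswap, sub_eq_zero] at h1
    simp only [Complex.real_smul]
    rw [h1]
    simp only [mul_comm]
  have := (Continuous.ae_eq_iff_eq volume hF hG).1 hae
  intro x
  simp only [← hhχ]
  exact congrFun this x

end BandLimited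

/-! ### Uniform approximation on BUC -/

section Approximation

variable {m : ℕ}

theorem integral_mul_fourierInv_comp_smul (F χ : EuclideanSpace ℝ (Fin m) → ℂ) {δ : ℝ} (hδ : 0 < δ)
    (x : EuclideanSpace ℝ (Fin m)) :
    ∫ y, F y * 𝓕⁻ (fun ξ => χ (δ • ξ)) (x - y) = ∫ v, F (x - δ • v) * 𝓕⁻ χ v := by
  set d := Module.finrank ℝ (EuclideanSpace ℝ (Fin m)) with hd
  have hpos : 0 < (δ ^ d)⁻¹ := by positivity
  have hscale : ∀ v, 𝓕⁻ χ v = ((δ ^ d : ℝ) : ℂ) * 𝓕⁻ (fun ξ => χ (δ • ξ)) (δ • v) := by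
    intro v
    have h := Measure.integral_comp_smul (volume : Measure (EuclideanSpace ℝ (Fin m)))
      (fun ξ => Complex.exp (((2 * Real.pi * inner ℝ ξ v : ℝ) : ℂ) * Complex.I) • χ ξ) δ
    rw [abs_of_pos hpos] at h
    rw [Real.fourierInv_eq', Real.fourierInv_eq']
    simp only [real_inner_smul_right, real_inner_smul_left] at h ⊢
    rw [h, Complex.real_smul, ← mul_assoc, ← Complex.ofReal_mul, mul_inv_cancel₀ (by positivity),
      Complex.ofReal_one, one_mul]
  rw [← integral_sub_left_eq_self _ volume x]
  simp only [sub_sub_cancel]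
  have h := Measure.integral_comp_smul (volume : Measure (EuclideanSpace ℝ (Fin m)))
    (fun y => F (x - y) * 𝓕⁻ (fun ξ => χ (δ • ξ)) y) δ
  rw [abs_of_pos hpos] at h
  have h2 : ∫ v, F (x - δ • v) * 𝓕⁻ χ v =
      ((δ ^ d : ℝ) : ℂ) * ∫ v, F (x - δ • v) * 𝓕⁻ (fun ξ => χ (δ • ξ)) (δ • v) := by
    rw [← integral_const_mul]
    congr 1
    ext v
    rw [hscale]
    ring
  rw [h2, h, Complex.real_smul, ← mul_assoc, ← Complex.ofReal_mul, mul_inv_cancel₀ (by positivity),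
    Complex.ofReal_one, one_mul]

/-- Uniform continuity handles close points; beyond distance `r`, the bound `2 * M` is absorbed by
the linear term. The linear growth is integrable against a Schwartz kernel. -/
theorem IsBUC.exists_abs_sub_le {f : EuclideanSpace ℝ (Fin m) → ℝ} (hf : IsBUC f) {ε : ℝ}
    (hε : 0 < ε) : ∃ L, 0 ≤ L ∧ ∀ x y, |f x - f y| ≤ ε + L * ‖x - y‖ := by
  obtain ⟨⟨M, hM⟩, hu⟩ := hf
  obtain ⟨r, hr, h⟩ := Metric.uniformContinuous_iff.1 hu ε hε
  have hM0 : 0 ≤ M := (abs_nonneg _).trans (hM 0)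
  refine ⟨2 * M / r, by positivity, fun x y => ?_⟩
  rcases lt_or_ge (dist x y) r with hxy | hxy
  · have h1 := h hxy
    rw [Real.dist_eq] at h1
    have : 0 ≤ 2 * M / r * ‖x - y‖ := by positivity
    linarith
  · rw [dist_eq_norm] at hxy
    have h1 : 2 * M ≤ 2 * M / r * ‖x - y‖ := by
      rw [div_mul_eq_mul_div, le_div_iff₀ hr]
      gcongr
    have h2 := abs_sub (f x) (f y)
    linarith [hM x, hM y]

/-- Band-limited kernels approximate the identity uniformly on `BUC`. -/
theorem IsBUC.exists_fourierInv_approx {f : EuclideanSpace ℝ (Fin m) → ℝ} (hf : IsBUC f) {ε : ℝ}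
    (hε : 0 < ε) :
    ∃ χ : EuclideanSpace ℝ (Fin m) → ℂ, HasCompactSupport χ ∧ ContDiff ℝ ∞ χ ∧
      ∀ x, ‖(f x : ℂ) - ∫ y, (f y : ℂ) * 𝓕⁻ χ (x - y)‖ < ε := by
  obtain ⟨χ, hχc, hχs, U, -, hU, hχU⟩ :=
    exists_bump_eq_one (isCompact_singleton (x := (0 : EuclideanSpace ℝ (Fin m))))
  have hχ0 : χ 0 = 1 := hχU 0 (hU rfl)
  set κ : 𝓢(EuclideanSpace ℝ (Fin m), ℂ) := 𝓕⁻ (hχc.toSchwartzMap hχs) with hκ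
  have hκχ : ∀ v, κ v = 𝓕⁻ χ v := fun v => by
    rw [hκ, SchwartzMap.fourierInv_coe]
    rfl
  have hκ1 : ∫ v, κ v = 1 := by
    have h : 𝓕 κ 0 = 1 := by
      rw [hκ, FourierTransform.fourier_fourierInv_eq]
      exact hχ0
    rw [SchwartzMap.fourier_coe, Real.fourier_eq'] at h
    simpa using h
  have hi1 : Integrable fun v => ‖κ v‖ := κ.integrable.norm
  have hi2 : Integrable fun v => ‖v‖ * ‖κ v‖ := by
    simpa using κ.integrable_pow_mul volume 1
  set A := ∫ v, ‖κ v‖ with hA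
  set B := ∫ v, ‖v‖ * ‖κ v‖ with hB
  have hA0 : 0 ≤ A := integral_nonneg fun v => norm_nonneg _
  have hB0 : 0 ≤ B := integral_nonneg fun v => by positivity
  -- The error is at most `ε / (2 * (A + 1)) * A + L * δ * B`. The added ones keep denominators
  -- positive and make each half strictly less than `ε / 2`.
  obtain ⟨L, hL0, hL⟩ := hf.exists_abs_sub_le (ε := ε / (2 * (A + 1))) (by positivity)
  set δ := ε / (2 * (L * B + 1)) with hδ
  have hδ0 : 0 < δ := by positivity
  refine ⟨fun ξ => χ (δ • ξ), hχc.comp_homeomorph (Homeomorph.smulOfNeZero δ hδ0.ne'),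
    hχs.comp (contDiff_const_smul δ), fun x => ?_⟩
  rw [integral_mul_fourierInv_comp_smul (fun y => (f y : ℂ)) χ hδ0 x]
  simp only [← hκχ]
  obtain ⟨⟨M, hM⟩, hu⟩ := hf
  have hint : Integrable fun v => (f (x - δ • v) : ℂ) * κ v := by
    have hc : Continuous fun v => (f (x - δ • v) : ℂ) :=
      Complex.continuous_ofReal.comp (hu.continuous.comp (by fun_prop))
    refine κ.integrable.bdd_mul (c := M) hc.aestronglyMeasurable
      (Filter.Eventually.of_forall fun v => ?_)
    rw [Complex.norm_real]
    exact hM _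
  have h1 : (f x : ℂ) - ∫ v, (f (x - δ • v) : ℂ) * κ v =
      ∫ v, ((f x : ℂ) - (f (x - δ • v) : ℂ)) * κ v := by
    simp_rw [sub_mul]
    rw [integral_sub (κ.integrable.const_mul _) hint, integral_const_mul, hκ1, mul_one]
  rw [h1]
  have h2 : ‖∫ v, ((f x : ℂ) - (f (x - δ • v) : ℂ)) * κ v‖ ≤
      ∫ v, (ε / (2 * (A + 1)) * ‖κ v‖ + L * δ * (‖v‖ * ‖κ v‖)) := by
    refine norm_integral_le_of_norm_le ((hi1.const_mul _).add (hi2.const_mul _))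
      (Filter.Eventually.of_forall fun v => ?_)
    have h3 := hL x (x - δ • v)
    rw [sub_sub_cancel, norm_smul, Real.norm_of_nonneg hδ0.le] at h3
    rw [norm_mul, ← Complex.ofReal_sub, Complex.norm_real, Real.norm_eq_abs]
    calc _ ≤ (ε / (2 * (A + 1)) + L * (δ * ‖v‖)) * ‖κ v‖ := by gcongr
      _ = _ := by ring
  refine h2.trans_lt ?_
  rw [integral_add (hi1.const_mul _) (hi2.const_mul _), integral_const_mul, integral_const_mul,
    ← hA, ← hB]
  have h4 : ε / (2 * (A + 1)) * A < ε / 2 := by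
    rw [div_mul_eq_mul_div, div_lt_div_iff₀ (by positivity) (by positivity)]
    nlinarith
  have h5 : L * δ * B < ε / 2 := by
    have hLB : 0 ≤ L * B := by positivity
    rw [mul_right_comm, hδ, ← mul_div_assoc, div_lt_div_iff₀ (by positivity) (by positivity)]
    nlinarith
  linarith

end Approximation

end

theorem theorem5 (m n : ℕ)
    (ι : EuclideanSpace ℝ (Fin m) →ₗᵢ[ℝ] EuclideanSpace ℂ (Fin n)) :
    (∀ f : EuclideanSpace ℝ (Fin m) → ℝ, Continuous f → (∃ M : ℝ, ∀ x, |f x| ≤ M) →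
        IsBandLimited f → IsDualFunction (fun x => coherentState (ι x)) f) ∧
    (∀ g : EuclideanSpace ℝ (Fin m) → ℝ,
        IsDualFunction (fun x => coherentState (ι x)) g → IsBUC g) ∧
    (∀ f : EuclideanSpace ℝ (Fin m) → ℝ, IsBUC f → ∀ ε : ℝ, 0 < ε →
        ∃ g : EuclideanSpace ℝ (Fin m) → ℝ,
          IsDualFunction (fun x => coherentState (ι x)) g ∧ ∀ x, |f x - g x| < ε) := by
  refine ⟨fun f hf ⟨M, hM⟩ hb => ?_, fun g hg => hg.isBUC, fun f hf ε hε => ?_⟩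
  · obtain ⟨χ, hχc, hχs, h⟩ := hb.eq_integral_mul_fourierInv hf hM
    convert! isDualFunction_re_integral_mul_fourierInv ι hf hM hχc hχs using 2 with x
    rw [← h x, Complex.ofReal_re]
  · obtain ⟨χ, hχc, hχs, h⟩ := hf.exists_fourierInv_approx hε
    obtain ⟨⟨M, hM⟩, hu⟩ := hf
    refine ⟨_, isDualFunction_re_integral_mul_fourierInv ι hu.continuous hM hχc hχs, fun x => ?_⟩
    refine lt_of_le_of_lt ?_ (h x)
    have := Complex.abs_re_le_norm ((f x : ℂ) - ∫ y, (f y : ℂ) * 𝓕⁻ χ (x - y))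
    rwa [Complex.sub_re, Complex.ofReal_re] at this
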